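/- Let $G$ be a group with a finite generating set $S$, let $|g|$ be the word length of $g\in G$ with respect to $S$ (the least $n$ such that $g$ is a product of $n$ elements of $S\cup S^{-1}$), and suppose that $G$ is hyperbolic with respect to $|\cdot|$: with $d(x,y)=|x^{-1}y|$ and $(x|y)_w=\tfrac12\big(d(w,x)+d(w,y)-d(x,y)\big)$, there is $\delta\ge 0$ such that $(x|z)_w\ge\min\{(x|y)_w,(y|z)_w\}-\delta$ for all $w,x,y,z\in G$. Then $(G,|\cdot|)$ has property (J), that is, the following holds. For real $k,\alpha\ge 0$ put $C_{k,\alpha}=\{g\in G: k-\alpha\le |g|\le k+\alpha\}$, and for $p\in\mathbb N_0$ let $P_p$ be the set of pairs $(a,b)\in G\times G$ with $2p\le |a|+|b|-|ab|<2p+2$. 1. There are constants $\alpha,\beta,\gamma>0$ and elements $u_{(g,s)}\in G$, for $g\in G$ and real $s$ with $0\le s<|g|+1$, such that (i) $u_{(g,s)}\in C_{s,\alpha}$ for all such $g,s$; (ii) $v_{(g,s)}:=u_{(g,s)}^{-1}g\in C_{|g|+1-s,\,\beta}$ for all such $g,s$; (iii) for all $p\in\mathbb N_0$ and all $(a,b)\in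 P_p$ there is $c(a,b)\in C_{p,\gamma}$ with $a=u_{(ab,\,|a|-p)}\,c(a,b)$ and $b=c(a,b)^{-1}\,v_{(ab,\,|a|-p)}$. 2. For all $\mu,\nu>0$ there is $N\in\mathbb N$ such that for all $b\in G$ and all real $p$ with $0\le p\le |b|$ the set $\{(c,v)\in C_{p,\mu}\times C_{|b|-p,\,\nu}: c^{-1}v=b\}$ has at most $N$ elements. -/

import Mathlib

/-- A length function on a (discrete) group. -/
structure LengthFunction (G : Type*) [Group G] where
  toFun : G → ℝ
  nonneg : ∀ g, 0 ≤ toFun g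
  map_one : toFun 1 = 0
  map_inv : ∀ g, toFun g⁻¹ = toFun g
  map_mul_le : ∀ g h, toFun (g * h) ≤ toFun g + toFun h

instance {G : Type*} [Group G] : CoeFun (LengthFunction G) (fun _ => G → ℝ) :=
  ⟨LengthFunction.toFun⟩

namespace LengthFunction

/-- The (left invariant) distance `d(x, y) = |x⁻¹ y|`. -/
def dist {G : Type*} [Group G] (L : LengthFunction G) (x y : G) : ℝ := L (x⁻¹ * y)

/-- The Gromov product `(x | y)_w` for the distance `d(x, y) = |x⁻¹ y|`. -/
noncomputable def gromovProduct {G : Type*} [Group G] (L : LengthFunction G) (w x y : G) : ℝ :=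
  (L.dist w x + L.dist w y - L.dist x y) / 2

/-- Gromov's definition of hyperbolicity of `G` with the distance `d(x, y) = |x⁻¹ y|`. -/
def IsHyperbolic {G : Type*} [Group G] (L : LengthFunction G) : Prop :=
  ∃ δ : ℝ, 0 ≤ δ ∧ ∀ w x y z : G,
    min (L.gromovProduct w x y) (L.gromovProduct w y z) - δ ≤ L.gromovProduct w x z

/-- The cancellation number `p(g, h)`: the natural number `p` such that
`2p ≤ |g| + |h| - |gh| < 2p + 2`, see `cancellationNumber_eq_iff`. -/
noncomputable def cancellationNumber {G : Type*} [Group G] (L : LengthFunction G) (g h : G) : ℕ :=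
  ⌊(L g + L h - L (g * h)) / 2⌋₊

theorem cancellationNumber_eq_iff {G : Type*} [Group G] (L : LengthFunction G) (g h : G) (p : ℕ) :
    L.cancellationNumber g h = p ↔
      2 * (p : ℝ) ≤ L g + L h - L (g * h) ∧ L g + L h - L (g * h) < 2 * (p : ℝ) + 2 := by
  have h0 := L.map_mul_le g h
  unfold cancellationNumber
  rw [Nat.floor_eq_iff (by linarith)]
  constructor <;> rintro ⟨h1, h2⟩ <;> constructor <;> linarith

/-- `P_p`, the set of pairs with cancellation number `p`. -/
def cancellationSet {G : Type*} [Group G] (L : LengthFunction G) (p : ℕ) : Set (G × G) :=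
  {x | L.cancellationNumber x.1 x.2 = p}

/-- The annulus `C_{k, α} = {g | k - α ≤ |g| ≤ k + α}`. -/
def annulus {G : Type*} [Group G] (L : LengthFunction G) (k α : ℝ) : Set G :=
  {g | k - α ≤ L g ∧ L g ≤ k + α}

/-- Property (J) of the pair `(G, |·|)`; the value `u g s` only matters for `0 ≤ s < |g| + 1`. -/
def PropertyJ {G : Type*} [Group G] (L : LengthFunction G) : Prop :=
  (∃ α β γ : ℝ, 0 < α ∧ 0 < β ∧ 0 < γ ∧
    ∃ u : G → ℝ → G,
      (∀ (g : G) (s : ℝ), 0 ≤ s → s < L g + 1 → u g s ∈ L.annulus s α) ∧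
      (∀ (g : G) (s : ℝ), 0 ≤ s → s < L g + 1 → (u g s)⁻¹ * g ∈ L.annulus (L g + 1 - s) β) ∧
      (∀ (p : ℕ) (a b : G), (a, b) ∈ L.cancellationSet p →
        ∃ c ∈ L.annulus p γ,
          a = u (a * b) (L a - p) * c ∧
          b = c⁻¹ * ((u (a * b) (L a - p))⁻¹ * (a * b)))) ∧
  (∀ μ ν : ℝ, 0 < μ → 0 < ν → ∃ N : ℕ, ∀ (b : G) (p : ℝ), 0 ≤ p → p ≤ L b →
    Set.encard {x : G × G | x.1 ∈ L.annulus p μ ∧ x.2 ∈ L.annulus (L b - p) ν ∧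
      x.1⁻¹ * x.2 = b} ≤ N)

end LengthFunction

/-- `g` is a product of `n` factors, each of them an element of `S` or the inverse of one. -/
def IsWordOfLength {G : Type*} [Group G] (S : Set G) (g : G) (n : ℕ) : Prop :=
  ∃ l : List G, l.length = n ∧ (∀ x ∈ l, x ∈ S ∨ x⁻¹ ∈ S) ∧ l.prod = g

theorem exists_isWordOfLength {G : Type*} [Group G] (S : Set G) (hS : Subgroup.closure S = ⊤)
    (g : G) : ∃ n, IsWordOfLength S g n := by
  have hg : g ∈ (Subgroup.closure S).toSubmonoid := by rw [hS]; exact Subgroup.mem_top g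
  rw [Subgroup.closure_toSubmonoid] at hg
  obtain ⟨l, hl, rfl⟩ := Submonoid.exists_list_of_mem_closure hg
  exact ⟨l.length, l, rfl, hl, rfl⟩

/-- The least length of a word in `S` and inverses of elements of `S` that spells `g`. -/
noncomputable def wordLengthNat {G : Type*} [Group G] (S : Set G) (g : G) : ℕ :=
  sInf {n | IsWordOfLength S g n}

theorem isWordOfLength_wordLengthNat {G : Type*} [Group G] (S : Set G)
    (hS : Subgroup.closure S = ⊤) (g : G) : IsWordOfLength S g (wordLengthNat S g) :=
  Nat.sInf_mem (exists_isWordOfLength S hS g)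

theorem IsWordOfLength.inv {G : Type*} [Group G] {S : Set G} {g : G} {n : ℕ}
    (h : IsWordOfLength S g n) : IsWordOfLength S g⁻¹ n := by
  obtain ⟨l, rfl, hl, rfl⟩ := h
  refine ⟨(l.map (fun x => x⁻¹)).reverse, by simp, ?_, (List.prod_inv_reverse l).symm⟩
  intro x hx
  simp only [List.mem_reverse, List.mem_map] at hx
  obtain ⟨y, hy, rfl⟩ := hx
  simpa [or_comm] using hl y hy

theorem IsWordOfLength.mul {G : Type*} [Group G] {S : Set G} {g h : G} {m n : ℕ}
    (hg : IsWordOfLength S g m) (hh : IsWordOfLength S h n) :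
    IsWordOfLength S (g * h) (m + n) := by
  obtain ⟨l, rfl, hl, rfl⟩ := hg
  obtain ⟨k, rfl, hk, rfl⟩ := hh
  refine ⟨l ++ k, by simp, ?_, by simp⟩
  intro x hx
  rcases List.mem_append.1 hx with hx | hx
  · exact hl x hx
  · exact hk x hx

theorem wordLengthNat_inv_le {G : Type*} [Group G] (S : Set G)
    (hS : Subgroup.closure S = ⊤) (g : G) : wordLengthNat S g⁻¹ ≤ wordLengthNat S g :=
  Nat.sInf_le (isWordOfLength_wordLengthNat S hS g).inv

/-- The word length of `G` with respect to a generating set `S`. -/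
noncomputable def wordLength {G : Type*} [Group G] (S : Set G) (hS : Subgroup.closure S = ⊤) :
    LengthFunction G where
  toFun g := (wordLengthNat S g : ℝ)
  nonneg g := Nat.cast_nonneg _
  map_one := by
    have h : wordLengthNat S (1 : G) ≤ 0 := Nat.sInf_le ⟨[], rfl, by simp, rfl⟩
    exact_mod_cast Nat.le_zero.1 h
  map_inv g := by
    have h1 := wordLengthNat_inv_le S hS g
    have h2 := wordLengthNat_inv_le S hS g⁻¹
    rw [inv_inv] at h2
    exact_mod_cast le_antisymm h1 h2
  map_mul_le g h := by
    have h1 : wordLengthNat S (g * h) ≤ wordLengthNat S g + wordLengthNat S h :=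
      Nat.sInf_le ((isWordOfLength_wordLengthNat S hS g).mul (isWordOfLength_wordLengthNat S hS h))
    exact_mod_cast h1

/-! Take `u g s` to be the vertex at distance `⌊s⌋` from 1 on a geodesic from 1 to `g`. By
hyperbolicity, a point whose Gromov product with `g` is large lies near that geodesic
(`inv_mul_le_of_hyperbolic`). For (iii) the point is `a`, compared with a geodesic to `ab`. For part
2 it is `c⁻¹`, compared with a geodesic to `b`: it lies in a ball of fixed radius about `u b p`, and
balls are finite because `S` is. -/

theorem IsWordOfLength.wordLengthNat_le {G : Type*} [Group G] {S : Set G} {g : G} {n : ℕ}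
    (h : IsWordOfLength S g n) : wordLengthNat S g ≤ n :=
  Nat.sInf_le h

/-- Every prefix of a word of minimal length has minimal length, and so has its complement. -/
theorem exists_wordLengthNat_eq_and_inv_mul {G : Type*} [Group G] (S : Set G)
    (hS : Subgroup.closure S = ⊤) (g : G) {k : ℕ} (hk : k ≤ wordLengthNat S g) :
    ∃ u : G, wordLengthNat S u = k ∧ wordLengthNat S (u⁻¹ * g) + k = wordLengthNat S g := by
  obtain ⟨l, hl, hlS, hlg⟩ := isWordOfLength_wordLengthNat S hS g
  have hsplit : (l.take k).prod * (l.drop k).prod = g := by rw [List.prod_take_mul_prod_drop, hlg]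
  have hdrop : (l.take k).prod⁻¹ * g = (l.drop k).prod := by rw [← hsplit, inv_mul_cancel_left]
  have h1 : wordLengthNat S (l.take k).prod ≤ k :=
    IsWordOfLength.wordLengthNat_le
      ⟨l.take k, by simp [hl, hk], fun x hx => hlS x (List.mem_of_mem_take hx), rfl⟩
  have h2 : wordLengthNat S (l.drop k).prod ≤ wordLengthNat S g - k :=
    IsWordOfLength.wordLengthNat_le
      ⟨l.drop k, by simp [hl], fun x hx => hlS x (List.mem_of_mem_drop hx), rfl⟩
  -- Subadditivity turns both upper bounds into equalities.
  have h3 := ((isWordOfLength_wordLengthNat S hS (l.take k).prod).mul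
    (isWordOfLength_wordLengthNat S hS (l.drop k).prod)).wordLengthNat_le
  rw [hsplit] at h3
  refine ⟨(l.take k).prod, ?_, ?_⟩
  · omega
  · rw [hdrop]; omega

theorem finite_setOf_isWordOfLength {G : Type*} [Group G] {S : Set G} (hfin : S.Finite) (n : ℕ) :
    {g : G | IsWordOfLength S g n}.Finite := by
  induction n with
  | zero =>
    refine (Set.finite_singleton (1 : G)).subset ?_
    rintro g ⟨l, hl, -, rfl⟩
    simp [List.length_eq_zero_iff.1 hl]
  | succ n ih =>
    have hT : {x : G | x ∈ S ∨ x⁻¹ ∈ S}.Finite :=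
      hfin.union (hfin.preimage inv_injective.injOn)
    refine (hT.image2 (· * ·) ih).subset ?_
    rintro g ⟨l, hl, hlS, rfl⟩
    obtain ⟨x, t, rfl⟩ := List.exists_cons_of_length_eq_add_one hl
    exact ⟨x, hlS x (by simp), t.prod,
      ⟨t, by simpa using hl, fun y hy => hlS y (by simp [hy]), rfl⟩, by simp⟩

/-- Balls for the word length of a finite generating set are finite. -/
theorem finite_setOf_wordLength_le {G : Type*} [Group G] {S : Set G} (hfin : S.Finite)
    (hS : Subgroup.closure S = ⊤) (R : ℝ) : {g : G | wordLength S hS g ≤ R}.Finite := by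
  refine ((Set.finite_Iic ⌊R⌋₊).biUnion fun n _ => finite_setOf_isWordOfLength hfin n).subset ?_
  intro g hg
  exact Set.mem_biUnion (Set.mem_Iic.2 (Nat.le_floor hg)) (isWordOfLength_wordLengthNat S hS g)

/-- For `0 ≤ s < |g| + 1` a geodesic from `1` to `g` has a vertex at distance `⌊s⌋` from `1`. -/
theorem exists_geodesic_point {G : Type*} [Group G] (S : Set G) (hS : Subgroup.closure S = ⊤)
    (g : G) (s : ℝ) : ∃ u : G, 0 ≤ s → s < wordLength S hS g + 1 →
      wordLength S hS u ≤ s ∧ s < wordLength S hS u + 1 ∧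
      wordLength S hS (u⁻¹ * g) = wordLength S hS g - wordLength S hS u := by
  by_cases h : 0 ≤ s ∧ s < wordLength S hS g + 1
  · obtain ⟨h0, h1⟩ := h
    have hk : ⌊s⌋₊ ≤ wordLengthNat S g := by
      refine Nat.lt_succ_iff.1 ((Nat.floor_lt h0).2 ?_)
      push_cast
      exact h1
    obtain ⟨u, hu, hv⟩ := exists_wordLengthNat_eq_and_inv_mul S hS g hk
    have hu' : wordLength S hS u = (⌊s⌋₊ : ℝ) := congrArg Nat.cast hu
    have hv' : wordLength S hS (u⁻¹ * g) + (⌊s⌋₊ : ℝ) = wordLength S hS g := by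
      have h := congrArg (Nat.cast (R := ℝ)) hv
      rwa [Nat.cast_add] at h
    refine ⟨u, fun _ _ => ⟨?_, ?_, ?_⟩⟩
    · rw [hu']; exact Nat.floor_le h0
    · rw [hu']; exact Nat.lt_floor_add_one s
    · linarith
  -- Junk value outside the range, so that `u` can be chosen as a total function.
  · exact ⟨1, fun h0 h1 => absurd ⟨h0, h1⟩ h⟩

/-- A point `x` whose Gromov product with `g` is at least `t` is close to any point `u` on a
geodesic from `1` to `g` at distance at least `t` from `1`. -/
theorem LengthFunction.inv_mul_le_of_hyperbolic {G : Type*} [Group G] (L : LengthFunction G)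
    {δ : ℝ} (hδ : ∀ w x y z : G,
      min (L.gromovProduct w x y) (L.gromovProduct w y z) - δ ≤ L.gromovProduct w x z)
    {g u x : G} {t : ℝ} (hgeo : L (u⁻¹ * g) = L g - L u) (hu : t ≤ L u)
    (hx : 2 * t ≤ L g + L x - L (x⁻¹ * g)) :
    L (u⁻¹ * x) ≤ L u + L x - 2 * t + 2 * δ := by
  have hsymm : L (g⁻¹ * x) = L (x⁻¹ * g) := by
    rw [← L.map_inv (x⁻¹ * g), mul_inv_rev, inv_inv]
  -- Since `u` is on a geodesic to `g`, `(u|g)_1 = |u| ≥ t`; hence `(u|x)_1 ≥ t - δ`, which is the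
  -- claim.
  have h := hδ 1 u g x
  simp only [gromovProduct, dist, inv_one, one_mul, hgeo, hsymm] at h
  have hmin : t ≤ min ((L u + L g - (L g - L u)) / 2) ((L g + L x - L (x⁻¹ * g)) / 2) :=
    le_min (by linarith) (by linarith)
  linarith

theorem mainTheorem4 {G : Type*} [Group G] (S : Set G) (hfin : S.Finite)
    (hgen : Subgroup.closure S = ⊤) (hyp : (wordLength S hgen).IsHyperbolic) :
    (wordLength S hgen).PropertyJ := by
  obtain ⟨δ, hδ0, hδ⟩ := hyp
  choose u hu using exists_geodesic_point S hgen
  have hfinite := finite_setOf_wordLength_le hfin hgen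
  generalize wordLength S hgen = L at *
  refine ⟨⟨1, 2, 2 + 2 * δ, one_pos, two_pos, by linarith, u, ?_, ?_, ?_⟩, ?_⟩
  · intro g s h0 h1
    obtain ⟨h2, h3, -⟩ := hu g s h0 h1
    exact ⟨by linarith, by linarith⟩
  · intro g s h0 h1
    obtain ⟨h2, h3, h4⟩ := hu g s h0 h1
    exact ⟨by linarith, by linarith⟩
  · intro p a b hab
    obtain ⟨hp1, hp2⟩ := (L.cancellationNumber_eq_iff a b p).1 hab
    have hb := L.map_mul_le a⁻¹ (a * b)
    rw [inv_mul_cancel_left, L.map_inv] at hb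
    have ha := L.map_mul_le (a * b) b⁻¹
    rw [mul_inv_cancel_right, L.map_inv] at ha
    -- `hb` gives `p ≤ |a|`, and `ha` gives `|a| - p < |ab| + 1`.
    obtain ⟨h2, h3, h4⟩ := hu (a * b) (L a - p) (by linarith) (by linarith)
    refine ⟨(u (a * b) (L a - p))⁻¹ * a, ⟨?_, ?_⟩, by group, by group⟩
    · have h := L.map_mul_le (u (a * b) (L a - p)) ((u (a * b) (L a - p))⁻¹ * a)
      rw [mul_inv_cancel_left] at h
      linarith
    -- The `- 1` covers both the rounding in `|u|` and the slack `2p + 2` in `P_p`.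
    · have h := L.inv_mul_le_of_hyperbolic hδ (x := a) (t := L a - p - 1) h4 (by linarith)
        (by rw [inv_mul_cancel_left]; linarith)
      linarith
  · intro μ ν hμ hν
    have hR := hfinite (2 + 2 * μ + ν + 2 * δ)
    refine ⟨hR.toFinset.card, fun b p hp0 hpb => ?_⟩
    obtain ⟨h2, h3, h4⟩ := hu b p hp0 (by linarith)
    rw [← Set.encard_coe_eq_coe_finsetCard, hR.coe_toFinset]
    refine Set.encard_le_encard_of_injOn (f := fun x : G × G => (u b p)⁻¹ * x.1⁻¹) ?_ ?_
    · rintro ⟨c, v⟩ ⟨⟨hc1, hc2⟩, ⟨-, hv⟩, hcv⟩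
      dsimp only at hc1 hc2 hv hcv
      have hcb : c * b = v := by rw [← hcv, mul_inv_cancel_left]
      -- `(c⁻¹|b)_1 ≥ p - (μ + ν)/2` by the annulus bounds; the `- 1` ensures `t ≤ |u|`.
      have h := L.inv_mul_le_of_hyperbolic hδ (x := c⁻¹) (t := p - 1 - (μ + ν) / 2) h4
        (by linarith) (by rw [inv_inv, hcb, L.map_inv]; linarith)
      rw [L.map_inv] at h
      change L ((u b p)⁻¹ * c⁻¹) ≤ _
      linarith
    -- `c` determines `v = cb`.
    · rintro ⟨c, v⟩ ⟨-, -, hcv⟩ ⟨c', v'⟩ ⟨-, -, hcv'⟩ h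
      obtain rfl : c = c' := inv_injective (mul_left_cancel h)
      exact Prod.ext rfl (mul_left_cancel (hcv.trans hcv'.symm))
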